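/- Let $c>0$, $0<\xi<c$ and $L>0$. For $N\in\mathbb N$ put $h=\frac{L}{N+1}$ and let $$\mathcal A_h^{FD}(\xi)=\begin{pmatrix}0&I\\-A_h&B_h\end{pmatrix}\in\mathbb R^{(2N+2)\times(2N+2)},\qquad A_h=\frac{c^2}{h^2}\begin{pmatrix}2&-1&&\\-1&2&\ddots&\\&\ddots&\ddots&-1\\&&-1&1\end{pmatrix}\in\mathbb R^{(N+1)\times(N+1)},$$ where all diagonal entries of the tridiagonal matrix in $A_h$ are $2$ except the last one, which is $1$, and where $B_h\in\mathbb R^{(N+1)\times(N+1)}$ has the single nonzero entry $(B_h)_{N+1,N+1}=-\xi/h$. (This is the first-order system matrix of the finite difference semi-discretization of $\ddot v=c^2v_{xx}$ on $(0,L)$ with $v(0,t)=0$ and $c^2v_x(L,t)=-\xi\dot v(L,t)$.) Let $$p(z)=z^{4N+6}+\tfrac{\xi}{c}z^{4N+5}-\tfrac{\xi}{c}z+1,$$ $$S_j=\Big\{z\in\mathbb C:\ \operatorname{Re}z\ge0,\ \operatorname{Im}z\ge0,\ |z|\le\tfrac{\xi+c}{2\xi},\ \operatorname{Arg}z\in\Big[\tfrac{2j\pi}{4N+5},\tfrac{(2j+1)\pi}{4N+5}\Big]\Big\}.$$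 There are constants $C$ and $N_0$, depending only on $c,\xi,L$, such that for every $N\ge N_0$ the eigenvalues of $\mathcal A_h^{FD}(\xi)$, counted with algebraic multiplicity, can be numbered $\lambda_1,\dots,\lambda_{2N+2}$ so that, for $1\le j\le N$, $\lambda_j=\frac{c}{h}\,(z_j-z_j^{-1})$ for a root $z_j$ of $p$ in $S_j$, and so that for all $j=1,\dots,2N+2$ $$h\,|\operatorname{Re}\lambda_j|\le Ch,\qquad \Big|\,h\,|\operatorname{Im}\lambda_j|-2c\Big|\sin\frac{2j\pi}{4N+5}\Big|\,\Big|\le Ch,\qquad h^2|\lambda_j|^2\le4c^2\sin^2\frac{2j\pi}{4N+5}+Ch .$$ That is, uniformly in $j$, $h|\operatorname{Re}\lambda_j|=O(h)$, $h|\operatorname{Im}\lambda_j|=2c\,|\sin\frac{2j\pi}{4N+5}|+O(h)$, and hence $h^2|\lambda_j|^2\le4c^2\sin^2\frac{2j\pi}{4N+5}+O(h)$. -/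

import Mathlib

/-- Mesh size of the uniform grid `0 = x₀ < x₁ < ⋯ < x_{N+1} = L`. -/
noncomputable def meshSize (L : ℝ) (N : ℕ) : ℝ := L / ((N : ℝ) + 1)

/-- The `(N+1) × (N+1)` finite difference stiffness matrix
`(c² / h²) · tridiag(-1, 2, -1)` whose last diagonal entry is `c² / h²` instead of `2 c² / h²`. -/
noncomputable def fdStiffness (c h : ℝ) (N : ℕ) : Matrix (Fin (N + 1)) (Fin (N + 1)) ℝ :=
  (c ^ 2 / h ^ 2) • Matrix.of fun i k : Fin (N + 1) =>
    if i = k then (if i = Fin.last N then (1 : ℝ) else 2)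
    else if (i : ℕ) + 1 = k ∨ (k : ℕ) + 1 = i then -1
    else 0

/-- The `(N+1) × (N+1)` boundary damping matrix: its only nonzero entry is the last diagonal one,
`-ξ / h`. -/
noncomputable def fdDamping (ξ h : ℝ) (N : ℕ) : Matrix (Fin (N + 1)) (Fin (N + 1)) ℝ :=
  Matrix.of fun i k : Fin (N + 1) => if i = Fin.last N ∧ k = Fin.last N then -ξ / h else 0

/-- The system matrix `(u₁, u₂) ↦ (u₂, -A u₁ + B u₂)` of the damped finite difference scheme. -/
noncomputable def fdSystem (c ξ h : ℝ) (N : ℕ) :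
    Matrix (Fin (N + 1) ⊕ Fin (N + 1)) (Fin (N + 1) ⊕ Fin (N + 1)) ℝ :=
  Matrix.fromBlocks 0 1 (-fdStiffness c h N) (fdDamping ξ h N)

/-- The complex eigenvalues of the system matrix, with algebraic multiplicity. -/
noncomputable def fdEigenvalues (c ξ h : ℝ) (N : ℕ) : Multiset ℂ :=
  ((fdSystem c ξ h N).map (fun x : ℝ => (x : ℂ))).charpoly.roots

/-- The polynomial `p(z) = z^(4N+6) + (ξ/c) z^(4N+5) - (ξ/c) z + 1`. -/
noncomputable def fdPoly (c ξ : ℝ) (N : ℕ) (z : ℂ) : ℂ :=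
  z ^ (4 * N + 6) + ((ξ / c : ℝ) : ℂ) * z ^ (4 * N + 5) - ((ξ / c : ℝ) : ℂ) * z + 1

/-- The sector `S_j` of the first quadrant:
`|z| ≤ (ξ + c) / (2 ξ)` and `2 j π / (4N+5) ≤ Arg z ≤ (2 j + 1) π / (4N+5)`. -/
def fdSector (c ξ : ℝ) (N j : ℕ) : Set ℂ :=
  {z : ℂ | 0 ≤ z.re ∧ 0 ≤ z.im ∧ ‖z‖ ≤ (ξ + c) / (2 * ξ) ∧
    Complex.arg z ∈ Set.Icc (2 * (j : ℝ) * Real.pi / (4 * (N : ℝ) + 5))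
      ((2 * (j : ℝ) + 1) * Real.pi / (4 * (N : ℝ) + 5))}

/-! Put `a = ξ/c` and `M = 4N+5`. The mode `z^(2k) - z^(-2k)` satisfies the interior difference
equation and the Dirichlet condition with `λ = (c/h)(z - z⁻¹)`, and the damped last row holds
exactly when `p(z) = 0` (for `z² ≠ 1`). So it suffices to find enough roots of `p`.

The equation `p(z) = 0` reads `z^M (z + a) = a z - 1`. Taking an `M`-th root on the branch labelled
`j` makes it a fixed point equation, with a map whose derivative is `O(1/M)` on a quarter disc of
radius between `1` and `1/a`. Banach's theorem gives a root for each `j ≤ N`. The signs of the two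
arguments involved place it in the sector; comparing `|z + a|` with `|a z - 1|` gives `|z| ≤ 1`, and
the exponential form gives `|z| ≥ exp(-K/M)`.

The resulting `N+1` eigenvalues are distinct and lie in the open upper half plane. With their
conjugates they make `2N+2` distinct eigenvalues of a matrix of size `2N+2`, hence all of them, each
simple. The estimates follow from `z = exp(-t + iθ)` with `t = O(h)` and `θ` within `O(h)` of the
required angle, up to the reflection `ψ ↦ π - ψ`. -/

/-! ### Roots of `p` by a contraction argument -/

/-- The `M`-th root branch whose fixed points solve `z ^ M * (z + a) = a * z - 1`. -/
noncomputable def rootBranch (a : ℝ) (M j : ℕ) (z : ℂ) : ℂ :=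
  Complex.exp ((Complex.log (1 - a * z) - Complex.log (z + a)
    + (2 * j + 1) * Real.pi * Complex.I) / M)

/-- The closed quarter disc of radius `R` in the first quadrant. -/
def quarterDisc (R : ℝ) : Set ℂ := {z : ℂ | 0 ≤ z.re ∧ 0 ≤ z.im ∧ ‖z‖ ≤ R}

lemma isClosed_quarterDisc (R : ℝ) : IsClosed (quarterDisc R) :=
  (isClosed_le continuous_const Complex.continuous_re).inter
    ((isClosed_le continuous_const Complex.continuous_im).inter
      (isClosed_le continuous_norm continuous_const))

lemma convex_quarterDisc (R : ℝ) : Convex ℝ (quarterDisc R) := by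
  have h : quarterDisc R =
      {z : ℂ | 0 ≤ z.re} ∩ ({z : ℂ | 0 ≤ z.im} ∩ Metric.closedBall 0 R) := by
    ext z
    simp [quarterDisc]
  rw [h]
  exact (convex_halfSpace_re_ge 0).inter
    ((convex_halfSpace_im_ge 0).inter (convex_closedBall 0 R))

lemma re_one_sub_mul_ge {a R : ℝ} (ha : 0 < a) {z : ℂ} (hz : z ∈ quarterDisc R) :
    1 - a * R ≤ (1 - a * z).re := by
  have h1 : z.re ≤ R := (Complex.re_le_norm z).trans hz.2.2
  simp
  nlinarith

lemma re_add_ge {a R : ℝ} {z : ℂ} (hz : z ∈ quarterDisc R) : a ≤ (z + a).re := by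
  simpa using hz.1

/-- In the first quadrant `1 - a z` has argument in `(-π/2, 0]` and `z + a` has argument in `[0,
π/2)`. This fixes the sector containing the value of the branch. -/
lemma log_ratio_im_mem {a R : ℝ} (ha : 0 < a) (haR : a * R < 1) {z : ℂ}
    (hz : z ∈ quarterDisc R) :
    -Real.pi < (Complex.log (1 - a * z) - Complex.log (z + a)).im ∧
      (Complex.log (1 - a * z) - Complex.log (z + a)).im ≤ 0 := by
  have h1 := re_one_sub_mul_ge ha hz
  have h2 := re_add_ge (a := a) hz
  have h3 : |Complex.arg (1 - a * z)| < Real.pi / 2 :=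
    Complex.abs_arg_lt_pi_div_two_iff.2 (Or.inl (by linarith))
  have h4 : |Complex.arg (z + a)| < Real.pi / 2 :=
    Complex.abs_arg_lt_pi_div_two_iff.2 (Or.inl (by linarith))
  have h5 : 0 ≤ Complex.arg (z + a) := by
    rw [Complex.arg_nonneg_iff]
    simpa using hz.2.1
  have h6 : Complex.arg (1 - a * z) ≤ 0 := by
    rcases hz.2.1.eq_or_lt with h0 | h0
    · refine le_of_eq (Complex.arg_eq_zero_iff.2 ⟨by linarith, ?_⟩)
      simp [← h0]
    · refine (Complex.arg_neg_iff.2 ?_).le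
      simp
      positivity
  rw [abs_lt] at h3 h4
  simp only [Complex.sub_im, Complex.log_im]
  constructor <;> linarith

lemma log_ratio_re_mem {a R : ℝ} (ha : 0 < a) (haR : a * R < 1) {z : ℂ}
    (hz : z ∈ quarterDisc R) :
    Real.log (1 - a * R) - Real.log (R + a)
        ≤ (Complex.log (1 - a * z) - Complex.log (z + a)).re ∧
      (Complex.log (1 - a * z) - Complex.log (z + a)).re ≤ Real.log 2 - Real.log a := by
  have h1 : 1 - a * R ≤ ‖1 - a * z‖ := (re_one_sub_mul_ge ha hz).trans (Complex.re_le_norm _)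
  have h2 : a ≤ ‖z + a‖ := (re_add_ge hz).trans (Complex.re_le_norm _)
  have hn := hz.2.2
  have h3 : ‖z + a‖ ≤ R + a := by
    refine (norm_add_le _ _).trans ?_
    rw [Complex.norm_real, Real.norm_of_nonneg ha.le]
    linarith
  have h4 : ‖1 - a * z‖ ≤ 2 := by
    refine (norm_sub_le _ _).trans ?_
    rw [norm_mul, Complex.norm_real, Real.norm_of_nonneg ha.le, norm_one]
    nlinarith
  simp only [Complex.sub_re, Complex.log_re]
  have h5 := Real.log_le_log (by linarith) h1
  have h6 := Real.log_le_log ha h2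
  have h7 := Real.log_le_log (by linarith) h3
  have h8 := Real.log_le_log (by linarith) h4
  constructor <;> linarith

lemma rootBranch_eq_exp {a R : ℝ} (ha : 0 < a) (haR : a * R < 1) {z : ℂ}
    (hz : z ∈ quarterDisc R) (M j : ℕ) : ∃ s φ : ℝ,
    rootBranch a M j z = Complex.exp ((s / M : ℝ) + (φ / M : ℝ) * Complex.I) ∧
    Real.log (1 - a * R) - Real.log (R + a) ≤ s ∧ s ≤ Real.log 2 - Real.log a ∧
    2 * j * Real.pi < φ ∧ φ ≤ (2 * j + 1) * Real.pi := by
  obtain ⟨h1, h2⟩ := log_ratio_im_mem ha haR hz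
  obtain ⟨h3, h4⟩ := log_ratio_re_mem ha haR hz
  refine ⟨(Complex.log (1 - a * z) - Complex.log (z + a)).re,
    (Complex.log (1 - a * z) - Complex.log (z + a)).im + (2 * j + 1) * Real.pi, ?_, h3, h4,
    by linarith, by linarith⟩
  rw [rootBranch]
  congr 1
  generalize Complex.log (1 - a * z) - Complex.log (z + a) = w
  conv_lhs => rw [← Complex.re_add_im w]
  push_cast
  ring

lemma rootBranch_mem_quarterDisc {a R : ℝ} (ha : 0 < a) (haR : a * R < 1) {z : ℂ}
    (hz : z ∈ quarterDisc R) {M j : ℕ} (hR : 1 < R)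
    (hM : (Real.log 2 - Real.log a) / Real.log R ≤ M) (hj : 2 * (2 * j + 1) ≤ M) :
    rootBranch a M j z ∈ quarterDisc R := by
  obtain ⟨s, φ, h, -, hs, hφ, hφ'⟩ := rootBranch_eq_exp ha haR hz M j
  have hM0 : (0 : ℝ) < M := by
    have : 0 < M := by omega
    exact_mod_cast this
  have hpi := Real.pi_pos
  have hφ0 : 0 ≤ φ / M := by
    have : 0 ≤ φ := le_trans (by positivity) hφ.le
    positivity
  have hφ1 : φ / M ≤ Real.pi / 2 := by
    have hj' : (2 * (2 * j + 1) : ℝ) ≤ M := by exact_mod_cast hj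
    rw [div_le_iff₀ hM0]
    nlinarith
  rw [h]
  refine ⟨?_, ?_, ?_⟩
  · rw [Complex.exp_re]
    simp only [Complex.add_re, Complex.ofReal_re, Complex.mul_re, Complex.I_re, Complex.I_im,
      Complex.ofReal_im, Complex.add_im, Complex.mul_im]
    refine mul_nonneg (Real.exp_pos _).le (Real.cos_nonneg_of_neg_pi_div_two_le_of_le ?_ ?_)
      <;> linarith
  · rw [Complex.exp_im]
    simp only [Complex.add_re, Complex.ofReal_re, Complex.mul_re, Complex.I_re, Complex.I_im,
      Complex.ofReal_im, Complex.add_im, Complex.mul_im]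
    refine mul_nonneg (Real.exp_pos _).le (Real.sin_nonneg_of_nonneg_of_le_pi ?_ ?_)
      <;> linarith
  · rw [Complex.norm_exp]
    simp only [Complex.add_re, Complex.ofReal_re, Complex.mul_re, Complex.I_re, Complex.I_im,
      Complex.ofReal_im]
    have hlog := Real.log_pos hR
    rw [← Real.le_log_iff_exp_le (by linarith)]
    have : s / M ≤ Real.log R := by
      rw [div_le_iff₀ hM0]
      rw [div_le_iff₀ hlog] at hM
      linarith
    linarith

lemma hasDerivAt_rootBranch {a R : ℝ} (ha : 0 < a) (haR : a * R < 1) {z : ℂ}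
    (hz : z ∈ quarterDisc R) (M j : ℕ) :
    HasDerivAt (rootBranch a M j)
      (rootBranch a M j z * (((-a) / (1 - a * z) - 1 / (z + a)) / M)) z := by
  have h1 := re_one_sub_mul_ge ha hz
  have h2 := re_add_ge (a := a) hz
  have d1 : HasDerivAt (fun w : ℂ => 1 - a * w) (-a : ℂ) z := by
    simpa using ((hasDerivAt_id z).const_mul (a : ℂ)).const_sub 1
  have d2 : HasDerivAt (fun w : ℂ => w + a) 1 z := (hasDerivAt_id z).add_const _
  exact ((((d1.clog (Or.inl (by linarith))).sub (d2.clog (Or.inl (by linarith)))).add_const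
    _).div_const _).cexp

/-- `|z + a|² - |a z - 1|² = (1 - a²)(|z|² - 1) + 4 a Re z` is positive when `|z| > 1` and `Re z ≥
0`, whereas the equation would then force `|z + a| ≤ |a z - 1|`. -/
lemma norm_le_one_of_pow_mul_eq {a : ℝ} (ha : 0 < a) (ha1 : a < 1) {M : ℕ} {z : ℂ}
    (hre : 0 ≤ z.re) (h : z ^ M * (z + a) = a * z - 1) : ‖z‖ ≤ 1 := by
  by_contra! hz
  have h1 : 1 ≤ ‖z‖ ^ M := one_le_pow₀ hz.le
  have h2 : ‖z + a‖ ≤ ‖a * z - 1‖ := by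
    rw [← h, norm_mul, norm_pow]
    exact le_mul_of_one_le_left (norm_nonneg _) h1
  have h3 : ‖z + a‖ ^ 2 ≤ ‖a * z - 1‖ ^ 2 := by gcongr
  have h4 : 1 < ‖z‖ ^ 2 := one_lt_pow₀ hz two_ne_zero
  rw [← Complex.normSq_eq_norm_sq] at h3 h4
  rw [← Complex.normSq_eq_norm_sq] at h3
  simp only [Complex.normSq_apply] at h3 h4
  simp at h3
  nlinarith [mul_nonneg ha.le hre, mul_pos (sub_pos.2 h4) (show 0 < 1 - a ^ 2 by nlinarith)]

/-- For `0 < a < 1` and large `M`, the equation `z ^ M * (z + a) = a * z - 1` has a root in each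
sector `2 j π / M < arg z ≤ (2 j + 1) π / M` of the first quadrant, within `O(1 / M)` of the unit
circle. -/
lemma exists_root_in_sector {a : ℝ} (ha : 0 < a) (ha1 : a < 1) :
    ∃ (K : ℝ) (M₀ : ℕ), 0 ≤ K ∧ ∀ M : ℕ, M₀ ≤ M → ∀ j : ℕ, 2 * (2 * j + 1) ≤ M →
      ∃ t θ : ℝ, 0 ≤ t ∧ t ≤ K / M ∧ 2 * j * Real.pi / M < θ ∧ θ ≤ (2 * j + 1) * Real.pi / M ∧
        Complex.exp (-t + θ * Complex.I) ^ M * (Complex.exp (-t + θ * Complex.I) + a) =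
          a * Complex.exp (-t + θ * Complex.I) - 1 := by
  obtain ⟨R, hR, haR⟩ : ∃ R : ℝ, 1 < R ∧ a * R < 1 := by
    -- For `a = ξ/c` this is `(ξ + c)/(2ξ)`, the radius of the sectors `S_j`.
    refine ⟨(1 + a) / (2 * a), ?_, ?_⟩
    · rw [lt_div_iff₀ (by linarith)]
      linarith
    · field_simp
      linarith
  set D : ℝ := R * (a / (1 - a * R) + 1 / a) with hD
  have h1aR : 0 < 1 - a * R := by linarith
  have hD0 : 0 ≤ D := by positivity
  obtain ⟨M₁, hM₁⟩ := exists_nat_ge ((Real.log 2 - Real.log a) / Real.log R)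
  obtain ⟨M₂, hM₂⟩ := exists_nat_gt D
  -- The root has `t = -s/M`, so the lower bound on `s` supplies the constant. `M₁` makes the branch
  -- a self-map of the quarter disc, `M₂` makes it contracting.
  refine ⟨|Real.log (1 - a * R) - Real.log (R + a)|, max M₁ M₂, abs_nonneg _, fun M hM j hj => ?_⟩
  have hMM₁ : (Real.log 2 - Real.log a) / Real.log R ≤ M :=
    hM₁.trans (by exact_mod_cast (le_max_left _ _).trans hM)
  have hMD : D < M := hM₂.trans_le (by exact_mod_cast (le_max_right _ _).trans hM)
  have hM0 : (0 : ℝ) < M := hD0.trans_lt hMD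
  have hmaps : Set.MapsTo (rootBranch a M j) (quarterDisc R) (quarterDisc R) :=
    fun z hz => rootBranch_mem_quarterDisc ha haR hz hR hMM₁ hj
  have hderiv : ∀ z ∈ quarterDisc R,
      ‖rootBranch a M j z * (((-a) / (1 - a * z) - 1 / (z + a)) / M)‖ ≤ D / M := by
    intro z hz
    have h1 : 1 - a * R ≤ ‖1 - a * z‖ := (re_one_sub_mul_ge ha hz).trans (Complex.re_le_norm _)
    have h2 : a ≤ ‖z + a‖ := (re_add_ge hz).trans (Complex.re_le_norm _)
    have h3 : ‖(-a : ℂ) / (1 - a * z) - 1 / (z + a)‖ ≤ a / (1 - a * R) + 1 / a := by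
      refine (norm_sub_le _ _).trans ?_
      rw [norm_div, norm_div, norm_neg, Complex.norm_real, Real.norm_of_nonneg ha.le, norm_one]
      gcongr
    rw [norm_mul, norm_div, Complex.norm_natCast, ← mul_div_assoc, hD]
    have h4 := (hmaps hz).2.2
    gcongr
  have hlip : LipschitzOnWith (D / M).toNNReal (rootBranch a M j) (quarterDisc R) := by
    refine (convex_quarterDisc R).lipschitzOnWith_of_nnnorm_hasDerivWithin_le
      (fun z hz => (hasDerivAt_rootBranch ha haR hz M j).hasDerivWithinAt) fun z hz => ?_
    rw [← NNReal.coe_le_coe, coe_nnnorm, Real.coe_toNNReal _ (by positivity)]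
    exact hderiv z hz
  have hcontr : ContractingWith (D / M).toNNReal (hmaps.restrict _ _ _) := by
    refine ⟨?_, hlip.mapsToRestrict hmaps⟩
    rw [Real.toNNReal_lt_one, div_lt_one hM0]
    exact hMD
  have h0 : (0 : ℂ) ∈ quarterDisc R := by
    simp [quarterDisc]
    linarith
  obtain ⟨z, hz, hfix, -⟩ := hcontr.exists_fixedPoint'
    (isClosed_quarterDisc R).isComplete hmaps h0 (edist_ne_top _ _)
  obtain ⟨s, φ, h, hs, -, hφ, hφ'⟩ := rootBranch_eq_exp ha haR hz M j
  have hroot : z ^ M * (z + a) = a * z - 1 := by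
    have e1 := re_one_sub_mul_ge ha hz
    have e2 := re_add_ge (a := a) hz
    have n1 : 1 - a * z ≠ 0 := fun h0 => by simp [h0] at e1; linarith
    have n2 : z + a ≠ 0 := fun h0 => by simp [h0] at e2; linarith
    have hMc : (M : ℂ) ≠ 0 := by exact_mod_cast hM0.ne'
    have hpow : z ^ M = -((1 - a * z) / (z + a)) := by
      conv_lhs => rw [← hfix.eq]
      rw [rootBranch, ← Complex.exp_nat_mul, mul_div_cancel₀ _ hMc, Complex.exp_add,
        Complex.exp_sub, Complex.exp_log n1, Complex.exp_log n2]
      have : Complex.exp ((2 * j + 1) * Real.pi * Complex.I) = -1 := by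
        rw [show ((2 * j + 1) * Real.pi * Complex.I : ℂ) =
          Real.pi * Complex.I + j * (2 * Real.pi * Complex.I) by ring,
          Complex.exp_add, Complex.exp_nat_mul_two_pi_mul_I, Complex.exp_pi_mul_I, mul_one]
      rw [this]
      ring
    rw [hpow]
    field_simp
    ring
  rw [hfix.eq] at h
  have hnorm := norm_le_one_of_pow_mul_eq ha ha1 hz.1 hroot
  have hs0 : s ≤ 0 := by
    rw [h, Complex.norm_exp] at hnorm
    simp only [Complex.add_re, Complex.ofReal_re, Complex.mul_re, Complex.I_re, Complex.I_im,
      Complex.ofReal_im, Real.exp_le_one_iff] at hnorm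
    by_contra! hs
    have : 0 < s / M := by positivity
    linarith
  have hz' : Complex.exp (-(-s / M : ℝ) + (φ / M : ℝ) * Complex.I) = z := by
    rw [h]
    push_cast
    ring_nf
  refine ⟨-s / M, φ / M, div_nonneg (by linarith) hM0.le, ?_, by gcongr, by gcongr, ?_⟩
  · gcongr
    exact le_trans (by linarith) (neg_le_abs _)
  · rw [hz']
    exact hroot

/-! ### Discrete modes and eigenvectors -/

/-- The solution `z ^ (2 k) - z ^ (-2 k)` of the recurrence of the interior grid points. -/
noncomputable def gridMode (z : ℂ) (k : ℕ) : ℂ := z ^ (2 * k) - (z⁻¹) ^ (2 * k)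

lemma gridMode_zero (z : ℂ) : gridMode z 0 = 0 := by simp [gridMode]

lemma gridMode_add_two {z : ℂ} (hz : z ≠ 0) (k : ℕ) :
    gridMode z (k + 2) = 2 * gridMode z (k + 1) - gridMode z k
      + (z - z⁻¹) ^ 2 * gridMode z (k + 1) := by
  simp only [gridMode, mul_add, pow_add, inv_pow]
  field_simp
  ring

/-- The last row of the system, after the recurrence eliminates the value at the last interior
neighbour in favour of a ghost value at `N+2`. The left side factors as `(z - z⁻¹) z^(-(2N+3))
p(z)`. -/
lemma gridMode_boundary {c ξ : ℝ} {N : ℕ} {z : ℂ} (hz : z ≠ 0) (hp : fdPoly c ξ N z = 0) :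
    gridMode z (N + 2) - gridMode z (N + 1)
      + ((ξ / c : ℝ) : ℂ) * (z - z⁻¹) * gridMode z (N + 1) = 0 := by
  have key : gridMode z (N + 2) - gridMode z (N + 1)
      + ((ξ / c : ℝ) : ℂ) * (z - z⁻¹) * gridMode z (N + 1)
      = (z - z⁻¹) * (z⁻¹) ^ (2 * N + 3) * fdPoly c ξ N z := by
    have e : 4 * N = 2 * N + 2 * N := by ring
    simp only [gridMode, fdPoly, mul_add, pow_add, e, inv_pow]
    generalize ((ξ / c : ℝ) : ℂ) = a
    field_simp
    ring
  rw [key, hp, mul_zero]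

lemma fdStiffness_mulVec (c h : ℝ) (N : ℕ) (U : ℕ → ℂ) (hU : U 0 = 0) (i : Fin (N + 1)) :
    ((fdStiffness c h N).map (fun x : ℝ => (x : ℂ))).mulVec (fun k => U (k + 1)) i =
      ((c / h : ℝ) : ℂ) ^ 2 * ((if i = Fin.last N then U (i + 1) else 2 * U (i + 1) - U (i + 2))
        - U i) := by
  have hentry : ∀ k : Fin (N + 1),
      ((fdStiffness c h N).map (fun x : ℝ => (x : ℂ))) i k * U (k + 1) =
      ((c / h : ℝ) : ℂ) ^ 2 * (
        (if (i : ℕ) = k then (if i = Fin.last N then 1 else 2) * U (k + 1) else 0)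
        - (if (i : ℕ) + 1 = k then U (k + 1) else 0)
        - (if (k : ℕ) + 1 = i then U (k + 1) else 0)) := by
    intro k
    simp only [fdStiffness, Matrix.map_apply, Matrix.smul_apply, Matrix.of_apply, smul_eq_mul,
      ← Fin.val_inj (a := i) (b := k)]
    have h3 : ¬ ((i : ℕ) = k ∧ (i : ℕ) + 1 = k) := by omega
    have h4 : ¬ ((i : ℕ) = k ∧ (k : ℕ) + 1 = i) := by omega
    have h5 : ¬ ((i : ℕ) + 1 = k ∧ (k : ℕ) + 1 = i) := by omega
    split_ifs <;> first | (exfalso; omega) | (push_cast; ring)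
  simp only [Matrix.mulVec, dotProduct, hentry]
  rw [← Finset.mul_sum, Finset.sum_sub_distrib, Finset.sum_sub_distrib,
    Fin.sum_univ_eq_sum_range (fun k : ℕ => if (i : ℕ) = k then
      (if i = Fin.last N then (1 : ℂ) else 2) * U (k + 1) else 0),
    Fin.sum_univ_eq_sum_range (fun k : ℕ => if (i : ℕ) + 1 = k then U (k + 1) else 0),
    Fin.sum_univ_eq_sum_range (fun k : ℕ => if k + 1 = (i : ℕ) then U (k + 1) else 0),
    Finset.sum_ite_eq, Finset.sum_ite_eq]
  have hprev : ∑ k ∈ Finset.range (N + 1), (if k + 1 = (i : ℕ) then U (k + 1) else 0) = U i := by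
    have hi := i.2
    rcases hi' : (i : ℕ) with _ | m
    · simp [hU]
    · simp only [add_left_inj, Finset.sum_ite_eq', Finset.mem_range]
      rw [if_pos (by omega)]
  rw [hprev]
  have hi := i.2
  simp only [Finset.mem_range, hi, if_true]
  congr 2
  by_cases hl : i = Fin.last N
  · simp [hl]
  · have : (i : ℕ) ≠ N := fun h0 => hl (Fin.ext h0)
    rw [if_neg hl, if_neg hl, if_pos (by omega)]

lemma fdDamping_mulVec (ξ h : ℝ) (N : ℕ) (u : Fin (N + 1) → ℂ) (i : Fin (N + 1)) :
    ((fdDamping ξ h N).map (fun x : ℝ => (x : ℂ))).mulVec u i =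
      if i = Fin.last N then ((-ξ / h : ℝ) : ℂ) * u i else 0 := by
  simp only [Matrix.mulVec, dotProduct, fdDamping, Matrix.map_apply, Matrix.of_apply]
  by_cases hi : i = Fin.last N
  · subst hi
    rw [Finset.sum_eq_single (Fin.last N)]
    · simp
    · intro k _ hk
      simp [hk]
    · simp
  · simp [hi]

/-- The eigenvector of the system matrix generated by a root `z` of `fdPoly`. -/
noncomputable def fdEigenvector (c h : ℝ) (N : ℕ) (z : ℂ) : Fin (N + 1) ⊕ Fin (N + 1) → ℂ :=
  Sum.elim (fun k => gridMode z (k + 1))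
    (fun k => ((c / h : ℝ) : ℂ) * (z - z⁻¹) * gridMode z (k + 1))

lemma fdSystem_mulVec_fdEigenvector {c ξ h : ℝ} (hc : c ≠ 0) (hh : h ≠ 0) {N : ℕ} {z : ℂ}
    (hz : z ≠ 0) (hp : fdPoly c ξ N z = 0) :
    ((fdSystem c ξ h N).map (fun x : ℝ => (x : ℂ))).mulVec (fdEigenvector c h N z) =
      (((c / h : ℝ) : ℂ) * (z - z⁻¹)) • fdEigenvector c h N z := by
  have hneg : (-fdStiffness c h N).map (fun x : ℝ => (x : ℂ)) =
      -((fdStiffness c h N).map (fun x : ℝ => (x : ℂ))) := by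
    ext i k
    simp
  have h1 : (1 : Matrix (Fin (N + 1)) (Fin (N + 1)) ℝ).map (fun x : ℝ => (x : ℂ)) = 1 :=
    Matrix.map_one _ Complex.ofReal_zero Complex.ofReal_one
  have h0 : (0 : Matrix (Fin (N + 1)) (Fin (N + 1)) ℝ).map (fun x : ℝ => (x : ℂ)) = 0 :=
    Matrix.map_zero _ Complex.ofReal_zero
  rw [fdSystem, fdEigenvector, Matrix.fromBlocks_map, Matrix.fromBlocks_mulVec, hneg, h1, h0]
  ext (i | i)
  · simp
  · simp only [Sum.elim_inr, Sum.elim_comp_inl, Sum.elim_comp_inr, Pi.add_apply, Pi.smul_apply,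
      smul_eq_mul, Matrix.neg_mulVec, Pi.neg_apply]
    rw [fdStiffness_mulVec c h N (gridMode z) (gridMode_zero z), fdDamping_mulVec]
    have hrec := gridMode_add_two hz (i : ℕ)
    by_cases hi : i = Fin.last N
    · subst hi
      rw [if_pos rfl, if_pos rfl]
      have hb := gridMode_boundary hz hp
      simp only [Fin.val_last] at hrec ⊢
      have hξ : ((-ξ / h : ℝ) : ℂ) = -((c / h : ℝ) : ℂ) * ((ξ / c : ℝ) : ℂ) := by
        rw [← Complex.ofReal_neg, ← Complex.ofReal_mul]
        congr 1
        field_simp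
      rw [hξ]
      linear_combination (-((c / h : ℝ) : ℂ) ^ 2) * hb + ((c / h : ℝ) : ℂ) ^ 2 * hrec
    · rw [if_neg hi, if_neg hi]
      linear_combination ((c / h : ℝ) : ℂ) ^ 2 * hrec

/-- The condition `z ^ 4 ≠ 1` makes the first entry `z² - z⁻²` of the eigenvector nonzero. -/
lemma mem_fdEigenvalues_of_fdPoly_eq_zero {c ξ h : ℝ} (hc : c ≠ 0) (hh : h ≠ 0) {N : ℕ} {z : ℂ}
    (hz : z ≠ 0) (hz4 : z ^ 4 ≠ 1) (hp : fdPoly c ξ N z = 0) :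
    ((c / h : ℝ) : ℂ) * (z - z⁻¹) ∈ fdEigenvalues c ξ h N := by
  rw [fdEigenvalues, Polynomial.mem_roots (Matrix.charpoly_monic _).ne_zero, Polynomial.IsRoot,
    Matrix.eval_charpoly, ← Matrix.exists_mulVec_eq_zero_iff]
  refine ⟨fdEigenvector c h N z, fun h0 => hz4 ?_, ?_⟩
  · have h1 : gridMode z 1 = 0 := by simpa [fdEigenvector] using congrFun h0 (Sum.inl 0)
    simp only [gridMode, inv_pow, mul_one] at h1
    field_simp at h1
    linear_combination h1
  · rw [Matrix.sub_mulVec, fdSystem_mulVec_fdEigenvector hc hh hz hp]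
    ext i
    simp [Matrix.scalar_apply]

lemma card_fdEigenvalues_le (c ξ h : ℝ) (N : ℕ) :
    Multiset.card (fdEigenvalues c ξ h N) ≤ 2 * N + 2 := by
  refine (Polynomial.card_roots' _).trans (le_of_eq ?_)
  rw [Matrix.charpoly_natDegree_eq_dim]
  simp
  ring

/-! ### The map `z ↦ z - z⁻¹` near the unit circle -/

lemma exp_sub_inv_re (t θ : ℝ) :
    (Complex.exp (-t + θ * Complex.I) - (Complex.exp (-t + θ * Complex.I))⁻¹).re =
      (Real.exp (-t) - Real.exp t) * Real.cos θ := by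
  rw [← Complex.exp_neg]
  simp [Complex.exp_re]
  ring

lemma exp_sub_inv_im (t θ : ℝ) :
    (Complex.exp (-t + θ * Complex.I) - (Complex.exp (-t + θ * Complex.I))⁻¹).im =
      (Real.exp (-t) + Real.exp t) * Real.sin θ := by
  rw [← Complex.exp_neg]
  simp [Complex.exp_im]
  ring

lemma abs_exp_neg_sub_exp_le {t : ℝ} (ht : 0 ≤ t) (ht1 : t ≤ 1) :
    |Real.exp (-t) - Real.exp t| ≤ 4 * t ∧ |Real.exp (-t) + Real.exp t - 2| ≤ 4 * t := by
  have h1 := Real.abs_exp_sub_one_le (x := t) (by rwa [abs_of_nonneg ht])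
  have h2 := Real.abs_exp_sub_one_le (x := -t) (by rwa [abs_neg, abs_of_nonneg ht])
  rw [abs_neg] at h2
  rw [abs_of_nonneg ht] at h1 h2
  rw [abs_le] at h1 h2 ⊢
  rw [abs_le]
  refine ⟨⟨?_, ?_⟩, ?_, ?_⟩ <;> linarith [h1.1, h1.2, h2.1, h2.2]

lemma exp_mul_exp_im_pos {t s θ φ : ℝ} (hθ : 0 < θ) (hφ : 0 < φ) (hθ' : θ < Real.pi / 2)
    (hφ' : φ < Real.pi / 2) :
    0 < (Complex.exp (-t + θ * Complex.I) * Complex.exp (-s + φ * Complex.I)).im := by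
  rw [← Complex.exp_add, Complex.exp_im]
  refine mul_pos (Real.exp_pos _) (Real.sin_pos_of_pos_of_lt_pi ?_ ?_)
  · simp
    positivity
  · simp
    linarith

lemma arg_exp_neg_add_mul_I {t θ : ℝ} (hθ : 0 < θ) (hθ' : θ < Real.pi / 2) :
    Complex.arg (Complex.exp (-t + θ * Complex.I)) = θ := by
  rw [← Complex.log_im, Complex.log_exp] <;> simp <;> linarith [Real.pi_pos]

lemma exp_pow_four_ne_one {t θ : ℝ} (hθ : 0 < θ) (hθ' : θ < Real.pi / 2) :
    Complex.exp (-t + θ * Complex.I) ^ 4 ≠ 1 := by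
  intro h
  have him := exp_mul_exp_im_pos (t := t) (s := t) hθ hθ hθ' hθ'
  generalize Complex.exp (-t + θ * Complex.I) = z at h him
  have : (z * z - 1) * (z * z + 1) = 0 := by linear_combination h
  rcases mul_eq_zero.1 this with h1 | h1
  · rw [sub_eq_zero.1 h1] at him
    simp at him
  · rw [eq_neg_of_add_eq_zero_left h1] at him
    simp at him

/-- Equality of `z - z⁻¹` and `w - w⁻¹` means `(z - w)(z w + 1) = 0`. The second factor cannot
vanish, since the arguments add up to an angle in `(0, π)` and `z w` is not real. -/
lemma angle_eq_of_exp_sub_inv_eq {t s θ φ : ℝ} (hθ : 0 < θ) (hφ : 0 < φ) (hθ' : θ < Real.pi / 2)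
    (hφ' : φ < Real.pi / 2)
    (h : Complex.exp (-t + θ * Complex.I) - (Complex.exp (-t + θ * Complex.I))⁻¹ =
      Complex.exp (-s + φ * Complex.I) - (Complex.exp (-s + φ * Complex.I))⁻¹) : θ = φ := by
  have him := exp_mul_exp_im_pos (t := t) (s := s) hθ hφ hθ' hφ'
  rw [← arg_exp_neg_add_mul_I (t := t) hθ hθ', ← arg_exp_neg_add_mul_I (t := s) hφ hφ']
  have hz := Complex.exp_ne_zero (-t + θ * Complex.I)
  have hw := Complex.exp_ne_zero (-s + φ * Complex.I)
  generalize Complex.exp (-t + θ * Complex.I) = z at *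
  generalize Complex.exp (-s + φ * Complex.I) = w at *
  congr 1
  have h1 : (z - w) * (z * w + 1) = 0 := by
    field_simp at h
    linear_combination h
  rcases mul_eq_zero.1 h1 with h2 | h2
  · exact sub_eq_zero.1 h2
  · rw [eq_neg_of_add_eq_zero_left h2] at him
    simp at him

lemma fdPoly_conj (c ξ : ℝ) (N : ℕ) (z : ℂ) :
    fdPoly c ξ N ((starRingEnd ℂ) z) = (starRingEnd ℂ) (fdPoly c ξ N z) := by
  simp [fdPoly]

/-- Real part, imaginary part and modulus of `(c / h) (z - z⁻¹)` for `z` close to the unit circle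
with argument close to `ψ`. -/
lemma scaled_sub_inv_bounds {c h L t θ ψ δ C : ℝ} (hc : 0 < c) (hh : 0 < h) (hhL : h ≤ L)
    (ht : 0 ≤ t) (ht1 : t ≤ 1) (hθψ : |θ - ψ| ≤ δ) (hC : 4 * c * t + 2 * c * δ ≤ C * h)
    {z l : ℂ} (hz : z = Complex.exp (-t + θ * Complex.I))
    (hre : |l.re| = |(((c / h : ℝ) : ℂ) * (z - z⁻¹)).re|)
    (him : |l.im| = |(((c / h : ℝ) : ℂ) * (z - z⁻¹)).im|) :
    h * |l.re| ≤ C * h ∧ |(h * |l.im| - 2 * c * |Real.sin ψ|)| ≤ C * h ∧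
      h ^ 2 * ‖l‖ ^ 2 ≤ 4 * c ^ 2 * Real.sin ψ ^ 2 + (4 * c * C + 2 * C ^ 2 * L) * h := by
  obtain ⟨h1, h2⟩ := abs_exp_neg_sub_exp_le ht ht1
  have hδ : 0 ≤ δ := (abs_nonneg _).trans hθψ
  have hcδ : 0 ≤ c * δ := by positivity
  have hct : 0 ≤ c * t := by positivity
  rw [Complex.re_ofReal_mul, hz, exp_sub_inv_re, abs_mul, abs_mul,
    abs_of_pos (div_pos hc hh)] at hre
  rw [Complex.im_ofReal_mul, hz, exp_sub_inv_im, abs_mul, abs_mul,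
    abs_of_pos (div_pos hc hh),
    abs_of_pos (show 0 < Real.exp (-t) + Real.exp t by positivity)] at him
  have hre' : h * |l.re| = c * (|Real.exp (-t) - Real.exp t| * |Real.cos θ|) := by
    rw [hre]
    field_simp
  have him' : h * |l.im| = c * ((Real.exp (-t) + Real.exp t) * |Real.sin θ|) := by
    rw [him]
    field_simp
  have hsin : |(|Real.sin θ| - |Real.sin ψ|)| ≤ δ :=
    (abs_abs_sub_abs_le _ _).trans ((Real.abs_sin_sub_sin_le θ ψ).trans hθψ)
  have b1 : h * |l.re| ≤ C * h := by
    have : |Real.exp (-t) - Real.exp t| * |Real.cos θ| ≤ 4 * t * 1 :=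
      mul_le_mul h1 (Real.abs_cos_le_one θ) (abs_nonneg _) (by positivity)
    rw [hre']
    nlinarith
  have b2 : |(h * |l.im| - 2 * c * |Real.sin ψ|)| ≤ C * h := by
    have e : h * |l.im| - 2 * c * |Real.sin ψ| =
        c * ((Real.exp (-t) + Real.exp t - 2) * |Real.sin θ|)
          + 2 * c * (|Real.sin θ| - |Real.sin ψ|) := by
      rw [him']
      ring
    have e1 : |Real.exp (-t) + Real.exp t - 2| * |Real.sin θ| ≤ 4 * t * 1 :=
      mul_le_mul h2 (Real.abs_sin_le_one θ) (abs_nonneg _) (by positivity)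
    rw [e]
    refine (abs_add_le _ _).trans ?_
    rw [abs_mul, abs_mul, abs_mul (2 * c), abs_abs, abs_of_pos hc,
      abs_of_pos (show 0 < 2 * c by linarith)]
    nlinarith
  refine ⟨b1, b2, ?_⟩
  have hn : h ^ 2 * ‖l‖ ^ 2 = (h * |l.re|) ^ 2 + (h * |l.im|) ^ 2 := by
    rw [← Complex.normSq_eq_norm_sq, Complex.normSq_apply, mul_pow, mul_pow, sq_abs, sq_abs]
    ring
  have hCh : 0 ≤ C * h := by linarith
  have g1 : (h * |l.re|) ^ 2 ≤ (C * h) ^ 2 := by gcongr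
  have g2 : (h * |l.im|) ^ 2 ≤ (2 * c * |Real.sin ψ| + C * h) ^ 2 := by
    gcongr
    linarith [(abs_le.1 b2).2]
  have g3 : c * |Real.sin ψ| * (C * h) ≤ c * 1 * (C * h) := by
    gcongr
    exact Real.abs_sin_le_one ψ
  -- One factor `h` of the quadratic error `2 C² h²` is absorbed using `h ≤ L`.
  have g4 : C ^ 2 * h * h ≤ C ^ 2 * h * L := by gcongr
  rw [hn, ← sq_abs (Real.sin ψ)]
  nlinarith

/-! ### Counting, numbering and estimating the eigenvalues -/

theorem theorem3p2 (c ξ L : ℝ) (hξ : 0 < ξ) (hξc : ξ < c) (hL : 0 < L) :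
    ∃ (C : ℝ) (N₀ : ℕ), ∀ N : ℕ, N₀ ≤ N →
      ∃ eig : ℕ → ℂ,
        -- `eig 1, …, eig (2N+2)` lists all eigenvalues, with multiplicity
        (Finset.Icc 1 (2 * N + 2)).val.map eig = fdEigenvalues c ξ (meshSize L N) N ∧
        -- for `1 ≤ j ≤ N`, the `j`-th eigenvalue comes from a root of `p` in the sector `S_j`
        (∀ j ∈ Finset.Icc 1 N, ∃ z ∈ fdSector c ξ N j, fdPoly c ξ N z = 0 ∧
          eig j = ((c / meshSize L N : ℝ) : ℂ) * (z - z⁻¹)) ∧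
        ∀ j ∈ Finset.Icc 1 (2 * N + 2),
          meshSize L N * |(eig j).re| ≤ C * meshSize L N ∧
          |(meshSize L N * |(eig j).im|
              - 2 * c * |Real.sin (2 * (j : ℝ) * Real.pi / (4 * (N : ℝ) + 5))| : ℝ)|
            ≤ C * meshSize L N ∧
          meshSize L N ^ 2 * ‖eig j‖ ^ 2
            ≤ 4 * c ^ 2 * Real.sin (2 * (j : ℝ) * Real.pi / (4 * (N : ℝ) + 5)) ^ 2
              + C * meshSize L N := by
  have hc : 0 < c := hξ.trans hξc
  have hpi := Real.pi_pos
  obtain ⟨K, M₀, hK, hroots⟩ := exists_root_in_sector (div_pos hξ hc) ((div_lt_one hc).2 hξc)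
  obtain ⟨N₁, hN₁⟩ := exists_nat_ge K
  -- From `4c·K/M + 2c·3π/M` and `1/M ≤ h/(4L)`; the angular error is at most `3π/M`.
  set C₁ : ℝ := c * (4 * K + 6 * Real.pi) / (4 * L) with hC₁
  have hC₁0 : 0 ≤ C₁ := by positivity
  refine ⟨C₁ + (4 * c * C₁ + 2 * C₁ ^ 2 * L), max M₀ N₁, fun N hN => ?_⟩
  have hM₀N : M₀ ≤ 4 * N + 5 := by
    have := (le_max_left _ _).trans hN
    omega
  have hKN : K ≤ N := hN₁.trans (by exact_mod_cast (le_max_right _ _).trans hN)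
  set h := meshSize L N with hh_def
  have hN0 : (0 : ℝ) ≤ N := N.cast_nonneg
  have hh : 0 < h := by
    rw [hh_def, meshSize]
    positivity
  have hhL : h ≤ L := div_le_self hL.le (by linarith)
  set M : ℝ := 4 * N + 5 with hM
  have hM0 : 0 < M := by positivity
  have hMcast : ((4 * N + 5 : ℕ) : ℝ) = M := by
    rw [hM]
    push_cast
    ring
  have hMh : 1 / M ≤ h / (4 * L) := by
    rw [hh_def, meshSize, div_div, div_le_div_iff₀ hM0 (by positivity)]
    rw [hM]
    nlinarith
  -- Here `j = 0` is included: it has no place among the indices `1, …, N`, but its eigenvalue is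
  -- needed for the count.
  have hroots' : ∀ j : ℕ, ∃ t θ : ℝ, j ≤ N → 0 ≤ t ∧ t ≤ K / M ∧ 2 * j * Real.pi / M < θ ∧
      θ ≤ (2 * j + 1) * Real.pi / M ∧ fdPoly c ξ N (Complex.exp (-t + θ * Complex.I)) = 0 := by
    intro j
    by_cases hj : j ≤ N
    · obtain ⟨t, θ, h1, h2, h3, h4, h5⟩ := hroots (4 * N + 5) hM₀N j (by omega)
      rw [hMcast] at h2 h3 h4
      refine ⟨t, θ, fun _ => ⟨h1, h2, h3, h4, ?_⟩⟩
      rw [fdPoly]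
      linear_combination h5
    · exact ⟨0, 0, fun h0 => absurd h0 hj⟩
  choose t θ htθ using hroots'
  set z : ℕ → ℂ := fun j => Complex.exp (-(t j) + θ j * Complex.I) with hz
  set lam : ℕ → ℂ := fun j => ((c / h : ℝ) : ℂ) * (z j - (z j)⁻¹) with hlam
  have hθpos : ∀ j ≤ N, 0 < θ j := fun j hj =>
    lt_of_le_of_lt (by positivity) (htθ j hj).2.2.1
  have hθlt : ∀ j ≤ N, θ j < Real.pi / 2 := by
    intro j hj
    refine (htθ j hj).2.2.2.1.trans_lt ?_
    have hj' : (j : ℝ) ≤ N := by exact_mod_cast hj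
    rw [div_lt_iff₀ hM0, hM]
    nlinarith
  have hθinj : ∀ i ≤ N, ∀ j ≤ N, θ i = θ j → i = j := by
    have aux : ∀ i ≤ N, ∀ j ≤ N, i < j → θ i < θ j := by
      intro i hi j hj hij
      refine (htθ i hi).2.2.2.1.trans_lt (lt_of_le_of_lt ?_ (htθ j hj).2.2.1)
      have : (i : ℝ) + 1 ≤ j := by exact_mod_cast hij
      gcongr
      linarith
    intro i hi j hj hij
    rcases lt_trichotomy i j with h1 | h1 | h1
    · exact absurd hij (aux i hi j hj h1).ne
    · exact h1
    · exact absurd hij (aux j hj i hi h1).ne'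
  have hlaminj : ∀ i ≤ N, ∀ j ≤ N, lam i = lam j → i = j := by
    intro i hi j hj hij
    have hch : ((c / h : ℝ) : ℂ) ≠ 0 := by exact_mod_cast (div_pos hc hh).ne'
    exact hθinj i hi j hj (angle_eq_of_exp_sub_inv_eq (hθpos i hi) (hθpos j hj) (hθlt i hi)
      (hθlt j hj) (mul_left_cancel₀ hch hij))
  have hlamim : ∀ j ≤ N, 0 < (lam j).im := by
    intro j hj
    simp only [hlam, hz]
    rw [Complex.im_ofReal_mul, exp_sub_inv_im]
    have := Real.sin_pos_of_pos_of_lt_pi (hθpos j hj) (by linarith [hθlt j hj])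
    positivity
  have hlam_mem : ∀ j ≤ N, lam j ∈ fdEigenvalues c ξ h N := fun j hj =>
    mem_fdEigenvalues_of_fdPoly_eq_zero hc.ne' hh.ne' (Complex.exp_ne_zero _)
      (exp_pow_four_ne_one (hθpos j hj) (hθlt j hj)) (htθ j hj).2.2.2.2
  have hconj_mem : ∀ j ≤ N, (starRingEnd ℂ) (lam j) ∈ fdEigenvalues c ξ h N := by
    intro j hj
    have e : (starRingEnd ℂ) (lam j) =
        ((c / h : ℝ) : ℂ) * ((starRingEnd ℂ) (z j) - ((starRingEnd ℂ) (z j))⁻¹) := by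
      simp only [hlam, map_mul, map_sub, map_inv₀, Complex.conj_ofReal]
    rw [e]
    refine mem_fdEigenvalues_of_fdPoly_eq_zero hc.ne' hh.ne' ?_ ?_ ?_
    · exact (map_ne_zero _).2 (Complex.exp_ne_zero _)
    · rw [← map_pow]
      intro h1
      refine exp_pow_four_ne_one (t := t j) (hθpos j hj) (hθlt j hj) ?_
      exact (starRingEnd ℂ).injective (h1.trans (map_one _).symm)
    · rw [fdPoly_conj, (htθ j hj).2.2.2.2, map_zero]
  -- The conjugates fill the indices `N+1, …, 2N+1` in reverse order, the lowest mode comes last.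
  set eig : ℕ → ℂ := fun j =>
    if j ≤ N then lam j else if j ≤ 2 * N + 1 then (starRingEnd ℂ) (lam (2 * N + 1 - j))
    else lam 0 with heig
  have hcases : ∀ j ∈ Finset.Icc 1 (2 * N + 2), ∃ i ≤ N,
      (eig j = lam i ∧ (j = i ∨ (i = 0 ∧ j = 2 * N + 2))) ∨
      (eig j = (starRingEnd ℂ) (lam i) ∧ j + i = 2 * N + 1) := by
    intro j hj
    rw [Finset.mem_Icc] at hj
    by_cases h1 : j ≤ N
    · exact ⟨j, h1, Or.inl ⟨by simp [heig, h1], Or.inl rfl⟩⟩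
    · by_cases h2 : j ≤ 2 * N + 1
      · exact ⟨2 * N + 1 - j, by omega, Or.inr ⟨by simp [heig, h1, h2], by omega⟩⟩
      · exact ⟨0, by omega, Or.inl ⟨by simp [heig, h1, h2], Or.inr ⟨rfl, by omega⟩⟩⟩
  have hinj : Set.InjOn eig (Finset.Icc 1 (2 * N + 2) : Finset ℕ) := by
    intro j hj k hk hjk
    have hne : ∀ a ≤ N, ∀ b ≤ N, lam a ≠ (starRingEnd ℂ) (lam b) := by
      intro a ha b hb hab
      have e1 := hlamim a ha
      have e2 := hlamim b hb
      rw [hab, Complex.conj_im] at e1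
      linarith
    obtain ⟨a, ha, hja⟩ := hcases j hj
    obtain ⟨b, hb, hkb⟩ := hcases k hk
    rw [Finset.mem_coe, Finset.mem_Icc] at hj hk
    rcases hja with ⟨ea, hja⟩ | ⟨ea, hja⟩ <;> rcases hkb with ⟨eb, hkb⟩ | ⟨eb, hkb⟩ <;>
      rw [ea, eb] at hjk
    · have := hlaminj a ha b hb hjk
      omega
    · exact absurd hjk (hne a ha b hb)
    · exact absurd hjk.symm (hne b hb a ha)
    · have := hlaminj a ha b hb ((starRingEnd ℂ).injective hjk)
      omega
  refine ⟨eig, ?_, ?_, ?_⟩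
  -- The `2N+2` distinct values are contained in a multiset of at most `2N+2` elements, so the two
  -- coincide.
  · refine Multiset.eq_of_le_of_card_le ?_ ?_
    · refine (Multiset.le_iff_subset
        ((Finset.Icc 1 (2 * N + 2)).nodup.map_on fun j hj k hk => hinj hj hk)).2 ?_
      intro x hx
      obtain ⟨j, hj, rfl⟩ := Multiset.mem_map.1 hx
      obtain ⟨i, hi, ⟨e, -⟩ | ⟨e, -⟩⟩ := hcases j hj
      · exact e ▸ hlam_mem i hi
      · exact e ▸ hconj_mem i hi
    · refine (card_fdEigenvalues_le c ξ h N).trans ?_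
      simp
  · intro j hj
    rw [Finset.mem_Icc] at hj
    obtain ⟨h1, h2, h3, h4, h5⟩ := htθ j hj.2
    have hR : 1 ≤ (ξ + c) / (2 * ξ) := by
      rw [le_div_iff₀ (by positivity)]
      linarith
    have hsin := Real.sin_nonneg_of_nonneg_of_le_pi (hθpos j hj.2).le
      (by linarith [hθlt j hj.2])
    have hcos := Real.cos_nonneg_of_neg_pi_div_two_le_of_le (by linarith [hθpos j hj.2])
      (hθlt j hj.2).le
    refine ⟨z j, ⟨?_, ?_, ?_, ?_⟩, h5, by simp [heig, hj.2, hlam]⟩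
    · simp only [hz, Complex.exp_re]
      refine mul_nonneg (Real.exp_pos _).le ?_
      simpa using hcos
    · simp only [hz, Complex.exp_im]
      refine mul_nonneg (Real.exp_pos _).le ?_
      simpa using hsin
    · refine le_trans ?_ hR
      simp [hz, Complex.norm_exp, h1]
    · rw [hz, arg_exp_neg_add_mul_I (hθpos j hj.2) (hθlt j hj.2)]
      exact ⟨h3.le, h4⟩
  · intro j hj
    have key : ∀ i ≤ N, ∀ ψ : ℝ, |θ i - ψ| ≤ 3 * Real.pi / M → Real.sin ψ =
        Real.sin (2 * j * Real.pi / M) → |(eig j).re| = |(lam i).re| →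
        |(eig j).im| = |(lam i).im| →
        h * |(eig j).re| ≤ C₁ * h ∧ |(h * |(eig j).im| - 2 * c * |Real.sin (2 * j * Real.pi / M)|)|
          ≤ C₁ * h ∧ h ^ 2 * ‖eig j‖ ^ 2 ≤ 4 * c ^ 2 * Real.sin (2 * j * Real.pi / M) ^ 2 +
            (4 * c * C₁ + 2 * C₁ ^ 2 * L) * h := by
      intro i hi ψ hψ hsin hre him
      obtain ⟨h1, h2, -⟩ := htθ i hi
      rw [← hsin]
      refine scaled_sub_inv_bounds hc hh hhL h1 (h2.trans ?_) hψ ?_ (z := z i) rfl hre him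
      · rw [div_le_one hM0, hM]
        linarith
      · calc 4 * c * t i + 2 * c * (3 * Real.pi / M)
            ≤ 4 * c * (K / M) + 2 * c * (3 * Real.pi / M) := by gcongr
          _ = c * (4 * K + 6 * Real.pi) * (1 / M) := by ring
          _ ≤ c * (4 * K + 6 * Real.pi) * (h / (4 * L)) := by gcongr
          _ = C₁ * h := by
            rw [hC₁]
            ring
    obtain ⟨b1, b2, b3⟩ : h * |(eig j).re| ≤ C₁ * h ∧
        |(h * |(eig j).im| - 2 * c * |Real.sin (2 * j * Real.pi / M)|)|
          ≤ C₁ * h ∧ h ^ 2 * ‖eig j‖ ^ 2 ≤ 4 * c ^ 2 * Real.sin (2 * j * Real.pi / M) ^ 2 +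
            (4 * c * C₁ + 2 * C₁ ^ 2 * L) * h := by
      obtain ⟨i, hi, hij⟩ := hcases j hj
      obtain ⟨-, -, h3, h4, -⟩ := htθ i hi
      rw [div_lt_iff₀ hM0] at h3
      rw [le_div_iff₀ hM0] at h4
      have habs : ∀ q : ℝ, |θ i * M - q * Real.pi| ≤ 3 * Real.pi →
          |θ i - q * Real.pi / M| ≤ 3 * Real.pi / M := by
        intro q hq
        rw [le_div_iff₀ hM0, ← abs_of_pos hM0, ← abs_mul, abs_of_pos hM0, sub_mul,
          div_mul_cancel₀ _ hM0.ne']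
        exact hq
      rcases hij with ⟨e, rfl | ⟨rfl, rfl⟩⟩ | ⟨e, hij⟩
      · refine key j hi (2 * j * Real.pi / M) (habs _ ?_) rfl (by rw [e]) (by rw [e])
        rw [abs_le]
        constructor <;> nlinarith
      -- For `j = 2N+2`, `2j = M - 1`, so the reflected angle is `π/M`, while `0 < θ 0 ≤ π/M`.
      · refine key 0 hi (1 * Real.pi / M) (habs _ ?_) ?_ (by rw [e]) (by rw [e])
        · push_cast at h3 h4
          rw [abs_le]
          constructor <;> nlinarith
        · rw [← Real.sin_pi_sub]
          congr 1
          push_cast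
          field_simp
          rw [hM]
          ring
      -- For `j = 2N+1-i`, `2j = M - (2i+3)`. Since `θ i` lies between `2iπ/M` and `(2i+1)π/M`, it
      -- is within `3π/M` of the reflected angle.
      · refine key i hi ((2 * i + 3) * Real.pi / M) (habs _ ?_) ?_ (by rw [e, Complex.conj_re])
          (by rw [e, Complex.conj_im, abs_neg])
        · rw [abs_le]
          constructor <;> nlinarith
        · rw [← Real.sin_pi_sub]
          congr 1
          have hij' : (j : ℝ) = 2 * N + 1 - i := by
            have : (j : ℝ) + i = 2 * N + 1 := by exact_mod_cast hij
            linarith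
          rw [hij']
          field_simp
          rw [hM]
          ring
    have hex : 0 ≤ (4 * c * C₁ + 2 * C₁ ^ 2 * L) * h := by positivity
    have hC₁h : 0 ≤ C₁ * h := by positivity
    refine ⟨?_, ?_, ?_⟩ <;> rw [add_mul] <;> linarith
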